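/- Let $n\ge 1$, let $d\ge 2$ be even, and let $\Sigma_{n,d}=\{1,\dots,n\}\times\{1,\dots,d\}\times\{1,\dots,n\}$. **Games.** A game graph with $n$ nodes and priorities up to $d$ has node set $\{1,\dots,n\}$, partitioned into nodes owned by Even and nodes owned by Odd, a starting node, and a set $E\subseteq\Sigma_{n,d}$ of edges $(u,p,v)$ (from $u$ to $v$, with priority $p$); every node has an outgoing edge. A play is an infinite path from the starting node, regarded as a word in $\Sigma_{n,d}^\omega$. $\mathrm{LimsupEven}_{n,d}$ (resp. $\mathrm{LimsupOdd}_{n,d}$) is the set of words in $\Sigma_{n,d}^\omega$ in which the largest priority occurring infinitely often is even (resp. odd); Even wins the plays in the former, Odd those in the latter. A positional strategy of a player is a set of edges containing exactly one outgoing edge of each of her nodes (and no other edges); the plays arising from it are those using only chosen edges at her nodes; it is winning if she wins all these plays. $\mathrm{PosEven}_{n,d}$ (resp. $\mathrm{PosOdd}_{n,d}$) is the set of all plays arising from positional winning strategies of Even (resp. Odd) in some game graph with $n$ nodes and priorities up to $d$. **Automata.** A parity automaton over $\Sigma_{n,d}$ has finitely many states, an initial state, and a total relation of transitions $(s,e,p,s')$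 (in state $s$, read $e$, emit the priority $p\in\{1,\dots,d'\}$, go to $s'$). A run is an infinite path of transitions from the initial state; it is accepting if the largest priority emitted infinitely often is even, and a word is accepted if some accepting run reads it. A transition strategy $\sigma$ chooses a transition as a function of the word read so far, the current state and the next letter; it is winning for a set of words $L$ if for every $w\in L$ the run obtained by following $\sigma$ while reading $w$ is accepting. A parity automaton is a *strong SFPG separator* (a strong separator suitable for parity games) if * it accepts all words of $\mathrm{PosEven}_{n,d}$ and rejects all words of $\mathrm{PosOdd}_{n,d}$ and of $\mathrm{LimsupOdd}_{n,d}$; and * for every game graph $G$ with $n$ nodes and priorities up to $d$ and every positional winning strategy $\tau$ of Even in $G$, it has a transition strategy winning for the set of plays arising from $\tau$. **The register automaton $\mathcal R_{n,d}$.** Let $r=1+\lfloor\log_2 n\rfloor$. The states are the non-increasing sequences $\langle r_r,\dots,r_2,r_1\rangle$ of numbers in $\{1,\dots,d\}$ (registers); the initial state is $\langle 1,\dots,1\rangle$. The update of a state by a letter $(u,p,v)$ replaces $r_1,\dots,r_k$ by $p$, where $k\geq 0$ is the greatest index such that $r_1,\dots,r_k<p$. For $1\le k\le r$, the $k$-reset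 of a state is $\langle r_r,\dots,r_{k+1},r_{k-1},\dots,r_1,1\rangle$; it is even or odd according to the parity of $r_k$. For every state $s$ and letter $e$, with $s'$ the update of $s$ by $e$, there are exactly the following transitions: the non-reset transition $(s,e,1,s')$; and, for each $1\le k\le r$ with $s''$ the $k$-reset of $s'$, the transition $(s,e,2k,s'')$ if this reset is even, and $(s,e,2k+1,s'')$ if it is odd. For a run $\rho$, let $\mathrm{bad}(\rho)$ be the greatest number $m$ such that some infix of $\rho$ contains $m$ transitions emitting some odd priority $p$ and no transitions emitting a higher priority ($\infty$ if there is no greatest such number). **Theorem.** The automaton $\mathcal R_{n,d}$ is a strong SFPG separator. Moreover, for every game graph $G$ with $n$ nodes and priorities up to $d$ and every positional winning strategy $\tau$ of Even in $G$, there is a transition strategy $\sigma$ of $\mathcal R_{n,d}$ that is winning for the set of plays arising from $\tau$ and such that every run $\rho$ of $\mathcal R_{n,d}$ that follows $\sigma$ and reads a play arising from $\tau$ satisfies $\mathrm{bad}(\rho)\le n-1$. -/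

import Mathlib

namespace ParityGames

/-! Nodes `{1, …, n}` are represented by `Fin n`; priorities are natural numbers in `{1, …, d}`. -/

/-- The set `{1, 2, …, d}` of priorities. -/
abbrev Prio (d : ℕ) : Type := ↥(Set.Icc 1 d)

/-- The alphabet `{1, …, n} × {1, …, d} × {1, …, n}` of (potential) edges. -/
@[ext]
structure Letter (n d : ℕ) where
  src : Fin n
  prio : Prio d
  tgt : Fin n

/-- Infinite words over the alphabet of edges. -/
abbrev Word (n d : ℕ) : Type := ℕ → Letter n d

/-- `p` is the largest number that occurs infinitely many times in the sequence `f`. -/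
def IsLimsupPrio (f : ℕ → ℕ) (p : ℕ) : Prop :=
  IsGreatest {q : ℕ | ∃ᶠ i in Filter.atTop, f i = q} p

/-- Words in which the largest priority occurring infinitely often is even. -/
def LimsupEven (n d : ℕ) : Set (Word n d) :=
  {w | ∃ p, IsLimsupPrio (fun i => ((w i).prio : ℕ)) p ∧ Even p}

/-- Words in which the largest priority occurring infinitely often is odd. -/
def LimsupOdd (n d : ℕ) : Set (Word n d) :=
  {w | ∃ p, IsLimsupPrio (fun i => ((w i).prio : ℕ)) p ∧ Odd p}

inductive Player where
  | even
  | odd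

/-- The words won by a player. -/
def Player.wins (n d : ℕ) : Player → Set (Word n d)
  | .even => LimsupEven n d
  | .odd => LimsupOdd n d

/-- A game graph with `n` nodes and priorities up to `d`; every node is owned by one of the
players and has at least one outgoing edge. -/
structure GameGraph (n d : ℕ) where
  owner : Fin n → Player
  start : Fin n
  edges : Set (Letter n d)
  exists_edge : ∀ v, ∃ e ∈ edges, e.src = v

/-- Plays of `G`: infinite paths that begin in the starting node. -/
def GameGraph.plays {n d : ℕ} (G : GameGraph n d) : Set (Word n d) :=
  {w | (w 0).src = G.start ∧ (∀ i, w i ∈ G.edges) ∧ ∀ i, (w i).tgt = (w (i + 1)).src}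

/-- A positional strategy for the player `P`: a set of edges going out of nodes owned by `P`,
exactly one such edge for each of these nodes. -/
structure PositionalStrategy {n d : ℕ} (G : GameGraph n d) (P : Player) where
  chosen : Set (Letter n d)
  chosen_subset : chosen ⊆ G.edges
  owner_src : ∀ e ∈ chosen, G.owner e.src = P
  existsUnique_chosen : ∀ v, G.owner v = P → ∃! e, e ∈ chosen ∧ e.src = v

namespace PositionalStrategy

variable {n d : ℕ} {G : GameGraph n d} {P : Player}

/-- The plays that arise from `P` playing the positional strategy `τ`. -/
def plays (τ : PositionalStrategy G P) : Set (Word n d) :=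
  {w | w ∈ G.plays ∧ ∀ i, G.owner (w i).src = P → w i ∈ τ.chosen}

/-- `τ` is winning for `P`: all plays that arise from it are won by `P`. -/
def IsWinning (τ : PositionalStrategy G P) : Prop :=
  ∀ w ∈ τ.plays, w ∈ P.wins n d

end PositionalStrategy

/-- All plays that arise from positional winning strategies of the player `P` in some game graph
with `n` nodes and priorities up to `d`. -/
def Pos (n d : ℕ) (P : Player) : Set (Word n d) :=
  {w | ∃ (G : GameGraph n d) (τ : PositionalStrategy G P), τ.IsWinning ∧ w ∈ τ.plays}

/-- `PosEven`: plays arising from positional winning strategies for Even. -/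
abbrev PosEven (n d : ℕ) : Set (Word n d) := Pos n d Player.even

/-- `PosOdd`: plays arising from positional winning strategies for Odd. -/
abbrev PosOdd (n d : ℕ) : Set (Word n d) := Pos n d Player.odd

/-- A quadruple (state, letter read, priority emitted, next state). -/
@[ext]
structure Transition (Q : Type) (n d : ℕ) where
  src : Q
  letter : Letter n d
  prio : ℕ
  tgt : Q

/-- Nondeterministic parity automata over the alphabet of edges, emitting priorities in
`{1, …, maxPrio}`, with a total transition relation. -/
structure ParityAutomaton (n d : ℕ) where
  State : Type
  finite_state : Finite State
  initial : State
  maxPrio : ℕ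
  trans : Set (Transition State n d)
  prio_mem : ∀ t ∈ trans, t.prio ∈ Set.Icc 1 maxPrio
  total : ∀ s e, ∃ t ∈ trans, t.src = s ∧ t.letter = e

namespace ParityAutomaton

variable {n d : ℕ}

/-- Runs: infinite paths of transitions that begin in the initial state. -/
structure Run (A : ParityAutomaton n d) where
  step : ℕ → Transition A.State n d
  step_mem : ∀ i, step i ∈ A.trans
  step_zero : (step 0).src = A.initial
  step_succ : ∀ i, (step i).tgt = (step (i + 1)).src

/-- The word read by a run. -/
def Run.word {A : ParityAutomaton n d} (ρ : A.Run) : Word n d := fun i => (ρ.step i).letter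

/-- A run is accepting if the largest priority emitted infinitely often is even. -/
def Run.Accepting {A : ParityAutomaton n d} (ρ : A.Run) : Prop :=
  ∃ p, IsLimsupPrio (fun i => (ρ.step i).prio) p ∧ Even p

/-- The words accepted by `A`. -/
def language (A : ParityAutomaton n d) : Set (Word n d) :=
  {w | ∃ ρ : A.Run, ρ.word = w ∧ ρ.Accepting}

/-- `bad ρ` is the supremum of the numbers `m` such that some finite block of consecutive
transitions of `ρ`, at positions `a, …, b - 1`, contains `m` transitions emitting some odd
priority `p`, and no transitions emitting a higher priority. It is `⊤` if these `m` are unbounded. -/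
noncomputable def Run.bad {A : ParityAutomaton n d} (ρ : A.Run) : ℕ∞ :=
  sSup {m : ℕ∞ | ∃ a b p : ℕ, Odd p ∧ (∀ i ∈ Finset.Ico a b, (ρ.step i).prio ≤ p) ∧
    m = (((Finset.Ico a b).filter (fun i => (ρ.step i).prio = p)).card : ℕ∞)}

/-- Transition strategies: functions choosing a transition, given the word read so far, the
current state, and the next letter. -/
structure TransitionStrategy (A : ParityAutomaton n d) where
  choose : List (Letter n d) → A.State → Letter n d → Transition A.State n d
  choose_mem : ∀ u s e, choose u s e ∈ A.trans
  choose_src : ∀ u s e, (choose u s e).src = s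
  choose_letter : ∀ u s e, (choose u s e).letter = e

/-- The run `ρ` follows the transition strategy `σ`. The list is the word of the first `i` letters
read by `ρ`. -/
def Run.Follows {A : ParityAutomaton n d} (ρ : A.Run) (σ : A.TransitionStrategy) : Prop :=
  ∀ i, ρ.step i = σ.choose ((List.range i).map ρ.word) (ρ.step i).src (ρ.word i)

/-- `σ` is winning for `L`: for every word `w ∈ L`, the (unique) run obtained by following `σ`
while reading `w` is accepting. -/
def TransitionStrategy.WinningFor {A : ParityAutomaton n d} (σ : A.TransitionStrategy)
    (L : Set (Word n d)) : Prop :=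
  ∀ w ∈ L, ∃ ρ : A.Run, ρ.word = w ∧ ρ.Follows σ ∧ ρ.Accepting

/-- Parity games separators. -/
def IsPGSeparator (A : ParityAutomaton n d) : Prop :=
  (∀ w ∈ PosEven n d, w ∈ A.language) ∧ (∀ w ∈ PosOdd n d, w ∉ A.language)

/-- Strong parity games separators. -/
def IsStrongPGSeparator (A : ParityAutomaton n d) : Prop :=
  A.IsPGSeparator ∧ ∀ w ∈ LimsupOdd n d, w ∉ A.language

/-- Separators that are suitable for parity games. -/
def IsSFPGSeparator (A : ParityAutomaton n d) : Prop :=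
  A.IsPGSeparator ∧
    ∀ (G : GameGraph n d) (τ : PositionalStrategy G Player.even), τ.IsWinning →
      ∃ σ : A.TransitionStrategy, σ.WinningFor τ.plays

/-- Strong SFPG separators. -/
def IsStrongSFPGSeparator (A : ParityAutomaton n d) : Prop :=
  A.IsStrongPGSeparator ∧ A.IsSFPGSeparator

end ParityAutomaton

/-- The number of registers, `1 + ⌊log₂ n⌋`. -/
def rn (n : ℕ) : ℕ := 1 + Nat.log 2 n

/-- Sequences of `rn n` registers holding numbers in `{1, …, d}`. The register number `k`, for
`k = 1, …, rn n`, is stored at the index `k - 1`; the sequence listed from the register `rn n` down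
to the register `1` is non-increasing. -/
abbrev Registers (n d : ℕ) : Type := {r : Fin (rn n) → Prio d // Monotone r}

namespace Registers

variable {n d : ℕ}

/-- The state `⟨1, 1, …, 1⟩`. -/
def ones (n : ℕ) (hd : 0 < d) : Registers n d :=
  ⟨fun _ => ⟨1, le_refl 1, hd⟩, fun _ _ _ => le_refl _⟩

/-- The update by the priority `p`: the registers `1, …, k` become `p`, where `k` is the greatest
index such that all of the registers `1, …, k` are smaller than `p`. -/
def update (s : Registers n d) (p : Prio d) : Registers n d :=
  ⟨fun i => if ∀ j ≤ i, s.1 j < p then p else s.1 i, by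
    intro i i' h
    dsimp only
    split_ifs with h1 h2 h2
    · exact le_refl _
    · by_contra hlt
      exact h2 fun j hj => lt_of_le_of_lt (s.2 hj) (not_le.mp hlt)
    · exact absurd (fun j hj => h2 j (le_trans hj h)) h1
    · exact s.2 h⟩

/-- The reset of the register at the index `k`: its value is removed, the values of the lower
registers are moved one register up, and the register `1` becomes `1`. -/
def reset (hd : 0 < d) (s : Registers n d) (k : Fin (rn n)) : Registers n d :=
  ⟨fun i =>
    if k < i then s.1 i
    else if i.val = 0 then ⟨1, le_refl 1, hd⟩
    else s.1 ⟨i.val - 1, lt_of_le_of_lt (Nat.sub_le _ _) i.isLt⟩, by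
    intro i i' h
    have hv : i.val ≤ i'.val := h
    dsimp only
    split_ifs with h1 h2 h3 h4 h5 h6 h7
    · exact s.2 h
    · exact absurd (lt_of_lt_of_le h1 h) h2
    · exact absurd (lt_of_lt_of_le h1 h) h2
    · exact (s.1 i').2.1
    · exact le_refl _
    · exact (s.1 _).2.1
    · exact s.2 (Fin.mk_le_of_le_val (by omega))
    · omega
    · exact s.2 (Fin.mk_le_mk.mpr (by omega))⟩

end Registers

/-- The transitions of the register automaton: non-reset transitions, and even and odd resets of
the registers. The index `k` stands for the register number `k + 1`. -/
inductive IsRegisterTransition {n d : ℕ} (hd : 0 < d) : Transition (Registers n d) n d → Prop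
  | nonReset (s : Registers n d) (e : Letter n d) :
      IsRegisterTransition hd ⟨s, e, 1, s.update e.prio⟩
  | evenReset (s : Registers n d) (e : Letter n d) (k : Fin (rn n))
      (h : Even ((s.update e.prio).1 k : ℕ)) :
      IsRegisterTransition hd ⟨s, e, 2 * (k.val + 1), (s.update e.prio).reset hd k⟩
  | oddReset (s : Registers n d) (e : Letter n d) (k : Fin (rn n))
      (h : Odd ((s.update e.prio).1 k : ℕ)) :
      IsRegisterTransition hd ⟨s, e, 2 * (k.val + 1) + 1, (s.update e.prio).reset hd k⟩

/-- The register automaton `R_{n,d}`. -/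
def registerAutomaton (n d : ℕ) (hd : 0 < d) : ParityAutomaton n d where
  State := Registers n d
  finite_state := inferInstance
  initial := Registers.ones n hd
  maxPrio := 2 * rn n + 1
  trans := {t | IsRegisterTransition hd t}
  prio_mem := by
    rintro t (⟨s, e⟩ | ⟨s, e, k, h⟩ | ⟨s, e, k, h⟩)
    · exact ⟨le_refl 1, by simp⟩
    · have := k.isLt
      exact ⟨by dsimp only; omega, by dsimp only; omega⟩
    · have := k.isLt
      exact ⟨by dsimp only; omega, by dsimp only; omega⟩
  total := fun s e => ⟨_, IsRegisterTransition.nonReset s e, rfl, rfl⟩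

end ParityGames

/-!
Rejection: suppose that a run reads a word whose greatest priority `v` occurring infinitely often is
odd, and that the greatest priority emitted infinitely often is `2 (K + 1)`. The resets at the
index `K` eventually flush everything above `v` out of the registers up to `K`. From then on reading
`v` puts `v` into the register `K`, where it stays until the next reset at `K`, which is then odd
(`odd_limsup_not_mem_language`). This rejects the words won by Odd, in particular all plays arising
from winning strategies of Odd.

Acceptance: let `H` be the set of edges compatible with a positional winning strategy of Even. On
the plays that arise from it, an edge closing a cycle in `H` on which it has the greatest priority
has an even priority (`ClosesCycle.even`). The transition strategy `resetStrategy` is memoryless and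
resets a register in each step. If the edge read, of priority `p`, closes such a cycle, let `k` be
the logarithm of the size of its strongly connected component in the graph of edges of priorities at
most `p`; otherwise let `k = 0`. The reset happens at the greatest index `j ≤ k` such that no
register below `j` is above `p`.

The bound on odd resets at an index `J`, in a block without higher resets, comes from the following.
For `J > 0`, the value removed by a reset at `J` is the greatest priority `v` read since the
preceding reset at `J` (`IsTrace.exists_update_eq`); for `J = 0` it is just the priority read. If
`v` is odd, then its edge does not close a cycle, so the path has jumped from one component to
another one, each of size at least `2 ^ J` (`IsJump`). Such a jump cannot be undone
(`IsJump.not_reach`): the greatest edge of a cycle undoing it would lie in a component of size at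
least `2 ^ (J + 1)`, and at that moment no register up to `J` is above its priority, so that the
strategy would reset at an index above `J`. Hence all jumps start in different nodes, none of which
is the last node reached. For `J > 0` the first odd reset need not end a jump, but then the
component from which the first jump starts has a second node, also left forever. In both cases there
are at most `n - 1` odd resets (`IsTrace.card_odd_resets_lt`). A finite bound of this kind makes a
run accepting (`ParityAutomaton.Run.accepting_of_bad_le`).
-/

namespace ParityGames

/-! ### Limits superior of bounded sequences -/

theorem IsLimsupPrio.eventually_le {f : ℕ → ℕ} {p M : ℕ} (h : IsLimsupPrio f p)
    (hM : ∀ i, f i ≤ M) : ∀ᶠ i in Filter.atTop, f i ≤ p := by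
  have key : ∀ q ∈ Finset.Ioc p M, ∀ᶠ i in Filter.atTop, f i ≠ q := by
    intro q hq
    by_contra hne
    rw [Filter.not_eventually] at hne
    have hle : q ≤ p := h.2 (hne.mono fun i hi => not_not.mp hi)
    exact absurd hle (not_le.mpr (Finset.mem_Ioc.mp hq).1)
  filter_upwards [(Filter.eventually_all_finset _).mpr key] with i hi
  by_contra hlt
  exact hi (f i) (Finset.mem_Ioc.mpr ⟨not_le.mp hlt, hM i⟩) rfl

theorem exists_isLimsupPrio {f : ℕ → ℕ} {M : ℕ} (hM : ∀ i, f i ≤ M) :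
    ∃ p, IsLimsupPrio f p := by
  have hbdd : BddAbove {q : ℕ | ∃ᶠ i in Filter.atTop, f i = q} := by
    refine ⟨M, fun q hq => ?_⟩
    obtain ⟨i, rfl⟩ := hq.exists
    exact hM i
  have hne : {q : ℕ | ∃ᶠ i in Filter.atTop, f i = q}.Nonempty := by
    by_contra hemp
    rw [Set.not_nonempty_iff_eq_empty] at hemp
    have key : ∀ q ∈ Finset.Iic M, ∀ᶠ i in Filter.atTop, f i ≠ q := by
      intro q _
      by_contra hcon
      rw [Filter.not_eventually] at hcon
      have hq : q ∈ {q : ℕ | ∃ᶠ i in Filter.atTop, f i = q} :=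
        hcon.mono fun i hi => not_not.mp hi
      rw [hemp] at hq
      exact hq
    obtain ⟨i, hi⟩ := ((Filter.eventually_all_finset _).mpr key).exists
    exact hi (f i) (Finset.mem_Iic.mpr (hM i)) rfl
  exact ⟨_, Nat.sSup_mem hne hbdd, fun q hq => le_csSup hbdd hq⟩

/-! ### Updates and resets of registers -/

namespace Registers

variable {n d : ℕ}

/-- As the registers are monotone, updating them amounts to taking pointwise maxima. -/
theorem update_apply (s : Registers n d) (p : Prio d) (i : Fin (rn n)) :
    (s.update p).1 i = max (s.1 i) p := by
  simp only [update]
  split_ifs with h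
  · exact (max_eq_right (h i le_rfl).le).symm
  · refine (max_eq_left ?_).symm
    by_contra hlt
    exact h fun j hj => lt_of_le_of_lt (s.2 hj) (not_le.mp hlt)

theorem update_apply_coe (s : Registers n d) (p : Prio d) (i : Fin (rn n)) :
    ((s.update p).1 i : ℕ) = max (s.1 i : ℕ) (p : ℕ) := by
  rw [update_apply]
  rcases le_total (s.1 i) p with h | h
  · rw [max_eq_right h, max_eq_right (Subtype.coe_le_coe.mpr h)]
  · rw [max_eq_left h, max_eq_left (Subtype.coe_le_coe.mpr h)]

theorem reset_apply_of_lt (hd : 0 < d) (s : Registers n d) {k i : Fin (rn n)} (h : k < i) :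
    (s.reset hd k).1 i = s.1 i := by
  simp [reset, h]

theorem reset_apply_zero (hd : 0 < d) (s : Registers n d) (k : Fin (rn n)) {i : Fin (rn n)}
    (h : i.val = 0) : ((s.reset hd k).1 i : ℕ) = 1 := by
  have hk : ¬ k < i := by
    rw [Fin.lt_def]
    omega
  simp [reset, h, hk]

theorem reset_apply_of_le (hd : 0 < d) (s : Registers n d) {k i : Fin (rn n)} (h : i ≤ k)
    (h0 : i.val ≠ 0) :
    (s.reset hd k).1 i = s.1 ⟨i.val - 1, lt_of_le_of_lt (Nat.sub_le _ _) i.isLt⟩ := by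
  simp [reset, not_lt.mpr h, h0]

/-- A reset never increases a register, because the value moved into it comes from a lower
register. -/
theorem reset_apply_le (hd : 0 < d) (s : Registers n d) (k i : Fin (rn n)) :
    (s.reset hd k).1 i ≤ s.1 i := by
  rcases lt_or_ge k i with h | h
  · rw [reset_apply_of_lt hd s h]
  · by_cases h0 : i.val = 0
    · rw [← Subtype.coe_le_coe, reset_apply_zero hd s k h0]
      exact (s.1 i).2.1
    · rw [reset_apply_of_le hd s h h0]
      exact s.2 (Fin.mk_le_of_le_val (Nat.sub_le _ _))

end Registers

/-! ### Words won by Odd are rejected -/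

theorem odd_limsup_not_mem_language {n d : ℕ} (hd : 0 < d) {w : Word n d}
    (hw : w ∈ LimsupOdd n d) : w ∉ (registerAutomaton n d hd).language := by
  rintro ⟨ρ, rfl, P, hP, hPeven⟩
  obtain ⟨v, hv, hvodd⟩ := hw
  let s : ℕ → Registers n d := fun i => (ρ.step i).src
  have hmem : ∀ i, IsRegisterTransition hd (ρ.step i) := ρ.step_mem
  have hsucc : ∀ i, (ρ.step i).tgt = s (i + 1) := ρ.step_succ
  have hvle := hv.eventually_le (M := d) fun i => (ρ.word i).prio.2.2
  have hPle := hP.eventually_le (M := 2 * rn n + 1) fun i =>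
    ((registerAutomaton n d hd).prio_mem _ (ρ.step_mem i)).2
  -- The even priority `P` is emitted, hence it comes from resets at a fixed index `K`.
  obtain ⟨K, hK⟩ : ∃ K : Fin (rn n), P = 2 * (K.val + 1) := by
    obtain ⟨i, hi⟩ := hP.1.exists
    have h := hmem i
    dsimp only at hi
    generalize ρ.step i = t at h hi
    subst hi
    cases h with
    | nonReset s e => exact absurd hPeven Nat.not_even_one
    | evenReset s e k h => exact ⟨k, rfl⟩
    | oddReset s e k h => exact absurd hPeven (by simp [parity_simps])
  -- What is known about a step emitting a priority at most `P`.
  have hstep : ∀ i, (ρ.step i).prio ≤ P →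
      (((ρ.step i).prio = P ∧ Even (((s i).update (ρ.word i).prio).1 K : ℕ) ∧
        s (i + 1) = ((s i).update (ρ.word i).prio).reset hd K) ∨
      ((ρ.step i).prio ≠ P ∧
        (s (i + 1)).1 K = ((s i).update (ρ.word i).prio).1 K)) ∧
      ∀ l, (s (i + 1)).1 l ≤ ((s i).update (ρ.word i).prio).1 l := by
    intro i hi
    have h := hmem i
    rw [← hsucc i]
    simp only [s, ParityAutomaton.Run.word]
    generalize ρ.step i = t at h hi
    cases h with
    | nonReset s e =>
      exact ⟨Or.inr ⟨by dsimp only; omega, rfl⟩, fun l => le_rfl⟩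
    | evenReset s e k h =>
      refine ⟨?_, Registers.reset_apply_le hd _ k⟩
      dsimp only at hi
      by_cases hkK : k = K
      · subst hkK
        exact Or.inl ⟨hK.symm, h, rfl⟩
      · have hne : k.val ≠ K.val := fun h => hkK (Fin.ext h)
        exact Or.inr ⟨by dsimp only; omega,
          Registers.reset_apply_of_lt hd _ (Fin.lt_def.mpr (by omega))⟩
    | oddReset s e k h =>
      refine ⟨?_, Registers.reset_apply_le hd _ k⟩
      dsimp only at hi
      exact Or.inr ⟨by dsimp only; omega,
          Registers.reset_apply_of_lt hd _ (Fin.lt_def.mpr (by omega))⟩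
  -- Values above `v` leave the registers up to `K`, since resets at `K` keep moving them up.
  have hregs : ∀ l : ℕ, ∀ hl : l < rn n, l ≤ K.val →
      ∀ᶠ i in Filter.atTop, ((s i).1 ⟨l, hl⟩ : ℕ) ≤ v := by
    intro l
    induction l with
    | zero =>
      intro hl hlK
      obtain ⟨N, hN⟩ := Filter.eventually_atTop.mp (hvle.and hPle)
      obtain ⟨a, ha, haP⟩ := (Filter.frequently_atTop.mp hP.1) N
      refine Filter.eventually_atTop.mpr ⟨a + 1, fun i hi => ?_⟩
      induction i, hi using Nat.le_induction with
      | base =>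
        rcases (hstep a haP.le).1 with h | h
        · rw [h.2.2, Registers.reset_apply_zero hd _ _ rfl]
          exact hvodd.pos
        · exact absurd haP h.1
      | succ i hi ih =>
        have h := Subtype.coe_le_coe.mpr ((hstep i (hN i (by omega)).2).2 ⟨0, hl⟩)
        rw [Registers.update_apply_coe] at h
        exact h.trans (max_le ih (hN i (by omega)).1)
    | succ l ihl =>
      intro hl hlK
      obtain ⟨N, hN⟩ := Filter.eventually_atTop.mp
        ((hvle.and hPle).and (ihl (by omega) (by omega)))
      obtain ⟨a, ha, haP⟩ := (Filter.frequently_atTop.mp hP.1) N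
      refine Filter.eventually_atTop.mpr ⟨a + 1, fun i hi => ?_⟩
      induction i, hi using Nat.le_induction with
      | base =>
        rcases (hstep a haP.le).1 with h | h
        · rw [h.2.2, Registers.reset_apply_of_le hd _ (Fin.le_def.mpr hlK) (Nat.succ_ne_zero l),
            Registers.update_apply_coe]
          exact max_le (hN a ha).2 (hN a ha).1.1
        · exact absurd haP h.1
      | succ i hi ih =>
        have h := Subtype.coe_le_coe.mpr ((hstep i (hN i (by omega)).1.2).2 ⟨l + 1, hl⟩)
        rw [Registers.update_apply_coe] at h
        exact h.trans (max_le ih (hN i (by omega)).1.1)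
  obtain ⟨N, hN⟩ := Filter.eventually_atTop.mp
    ((hvle.and hPle).and (hregs K.val K.isLt le_rfl))
  -- Once `v` is read, it stays in the register `K` until the next reset at `K`, which is then odd.
  obtain ⟨t, ht, htv⟩ := (Filter.frequently_atTop.mp hv.1) N
  have hex : ∃ m, t ≤ m ∧ (ρ.step m).prio = P := (Filter.frequently_atTop.mp hP.1) t
  classical
  have hkeep : ∀ i, t ≤ i → i ≤ Nat.find hex →
      (((s i).update (ρ.word i).prio).1 K : ℕ) = v := by
    intro i hi
    induction i, hi using Nat.le_induction with
    | base =>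
      intro _
      dsimp only at htv
      rw [Registers.update_apply_coe, htv]
      exact max_eq_right (hN t ht).2
    | succ i hi ih =>
      intro him
      rcases (hstep i (hN i (by omega)).1.2).1 with h | h
      · exact absurd ⟨hi, h.1⟩ (Nat.find_min hex him)
      · rw [Registers.update_apply_coe, h.2, ih (by omega)]
        exact max_eq_left (hN (i + 1) (by omega)).1.1
  have hspec := Nat.find_spec hex
  rcases (hstep _ hspec.2.le).1 with h | h
  · rw [hkeep _ hspec.1 le_rfl] at h
    exact Nat.not_even_iff_odd.mpr hvodd h.2.1
  · exact h.1 hspec.2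

/-! ### Reachability and strongly connected components -/

section Reachability

variable {n d : ℕ}

/-- There is an edge in `H` from `x` to `y` of priority at most `p`. -/
def EdgeLE (H : Set (Letter n d)) (p : ℕ) (x y : Fin n) : Prop :=
  ∃ e ∈ H, e.src = x ∧ e.tgt = y ∧ (e.prio : ℕ) ≤ p

/-- `y` is reachable from `x` by edges in `H` of priorities at most `p`. -/
def Reach (H : Set (Letter n d)) (p : ℕ) : Fin n → Fin n → Prop :=
  Relation.ReflTransGen (EdgeLE H p)

theorem Reach.mono {H : Set (Letter n d)} {p q : ℕ} {x y : Fin n} (h : Reach H p x y)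
    (hpq : p ≤ q) : Reach H q x y :=
  Relation.ReflTransGen.mono (r := EdgeLE H p)
    (fun _ _ ⟨e, he, hs, ht, hp⟩ => ⟨e, he, hs, ht, hp.trans hpq⟩) _ _ h

theorem Reach.trans {H : Set (Letter n d)} {p : ℕ} {x y z : Fin n} (h : Reach H p x y)
    (h' : Reach H p y z) : Reach H p x z :=
  Relation.ReflTransGen.trans h h'

open Classical in
/-- The strongly connected component of `x` in the graph of edges in `H` of priorities at
most `p`. -/
noncomputable def scc (H : Set (Letter n d)) (p : ℕ) (x : Fin n) : Finset (Fin n) :=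
  Finset.univ.filter fun y => Reach H p x y ∧ Reach H p y x

theorem mem_scc {H : Set (Letter n d)} {p : ℕ} {x y : Fin n} :
    y ∈ scc H p x ↔ Reach H p x y ∧ Reach H p y x := by
  simp [scc]

theorem self_mem_scc (H : Set (Letter n d)) (p : ℕ) (x : Fin n) : x ∈ scc H p x :=
  mem_scc.mpr ⟨Relation.ReflTransGen.refl, Relation.ReflTransGen.refl⟩

theorem scc_subset {H : Set (Letter n d)} {p q : ℕ} {x y : Fin n} (hpq : p ≤ q)
    (hxy : Reach H q x y) (hyx : Reach H q y x) : scc H p y ⊆ scc H q x := by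
  intro z hz
  rw [mem_scc] at hz ⊢
  exact ⟨hxy.trans (hz.1.mono hpq), (hz.2.mono hpq).trans hyx⟩

/-- The edge `e` lies on a cycle on which it has the greatest priority. -/
def ClosesCycle (H : Set (Letter n d)) (e : Letter n d) : Prop :=
  Reach H e.prio e.tgt e.src

/-- An infinite path in `H`. -/
def IsPath (H : Set (Letter n d)) (w : Word n d) : Prop :=
  (∀ i, w i ∈ H) ∧ ∀ i, (w i).tgt = (w (i + 1)).src

theorem IsPath.reach {H : Set (Letter n d)} {w : Word n d} (hw : IsPath H w) {a b q : ℕ}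
    (hab : a ≤ b) (hq : ∀ i, a ≤ i → i < b → ((w i).prio : ℕ) ≤ q) :
    Reach H q (w a).src (w b).src := by
  induction b, hab using Nat.le_induction with
  | base => exact Relation.ReflTransGen.refl
  | succ b hab ih =>
    exact Relation.ReflTransGen.tail (ih fun i hi hib => hq i hi (by omega))
      ⟨w b, hw.1 b, rfl, hw.2 b, hq b hab (by omega)⟩

theorem Reach.exists_path {H : Set (Letter n d)} {p : ℕ} {x y : Fin n} (h : Reach H p x y) :
    ∃ (N : ℕ) (f : ℕ → Fin n), f 0 = x ∧ f N = y ∧ ∀ i < N, EdgeLE H p (f i) (f (i + 1)) := by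
  induction h with
  | refl => exact ⟨0, fun _ => x, rfl, rfl, fun i hi => absurd hi (Nat.not_lt_zero i)⟩
  | @tail b c _ hbc ih =>
    obtain ⟨N, f, h0, hN, hf⟩ := ih
    refine ⟨N + 1, fun i => if i ≤ N then f i else c, by simpa using h0, by simp, ?_⟩
    intro i hi
    rcases Nat.lt_succ_iff_lt_or_eq.mp hi with h | h
    · simpa [h.le, Nat.succ_le_of_lt h] using hf i h
    · subst h
      simpa [hN] using hbc

/-- An edge of an infinite path closing a cycle can be repeated forever; if all infinite paths from
the same node are won by Even, its priority is thus even. -/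
theorem ClosesCycle.even {H : Set (Letter n d)} {w : Word n d} (hw : IsPath H w)
    (hwin : ∀ w', IsPath H w' → (w' 0).src = (w 0).src → w' ∈ LimsupEven n d) {m : ℕ}
    (hm : ClosesCycle H (w m)) : Even ((w m).prio : ℕ) := by
  obtain ⟨N, f, h0, hN, hf⟩ := hm.exists_path
  have : Nonempty (Letter n d) := ⟨w m⟩
  choose! g hgH hgs hgt hgp using hf
  -- The cycle: the edge `w m`, followed by the edges `g 0, …, g (N - 1)`.
  let c : ℕ → Letter n d := fun i => if i = 0 then w m else g (i - 1)
  have hcH : ∀ i ≤ N, c i ∈ H ∧ ((c i).prio : ℕ) ≤ (w m).prio := by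
    intro i hi
    simp only [c]
    split_ifs with h
    · exact ⟨hw.1 m, le_rfl⟩
    · exact ⟨hgH _ (by omega), hgp _ (by omega)⟩
  have hct : ∀ i ≤ N, (c i).tgt = f i := by
    intro i hi
    simp only [c]
    split_ifs with h
    · rw [h, h0]
    · rw [hgt _ (by omega), Nat.sub_add_cancel (by omega)]
  have hcs : ∀ i ≤ N, (c i).src = if i = 0 then (w m).src else f (i - 1) := by
    intro i hi
    simp only [c]
    split_ifs with h
    · rfl
    · exact hgs _ (by omega)
  let w' : Word n d := fun i => if i < m then w i else c ((i - m) % (N + 1))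
  have hmod : ∀ i, i % (N + 1) ≤ N := fun i => Nat.lt_succ_iff.mp (Nat.mod_lt _ (Nat.succ_pos N))
  have hper : ∀ k, w' (m + k * (N + 1)) = w m := by
    intro k
    simp [w', c]
  have hpath : IsPath H w' := by
    constructor
    · intro i
      simp only [w']
      split_ifs
      · exact hw.1 i
      · exact (hcH _ (hmod _)).1
    · intro i
      simp only [w']
      rcases lt_trichotomy (i + 1) m with h | h | h
      · rw [if_pos (by omega), if_pos h]
        exact hw.2 i
      · rw [if_pos (by omega), if_neg (by omega), h, Nat.sub_self, Nat.zero_mod]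
        simp only [c, if_true]
        rw [← h]
        exact hw.2 i
      · rw [if_neg (by omega), if_neg (by omega), hct _ (hmod _), hcs _ (hmod _),
          show i + 1 - m = (i - m) + 1 by omega]
        rcases (hmod (i - m)).lt_or_eq with h' | h'
        · have : (i - m + 1) % (N + 1) = (i - m) % (N + 1) + 1 := by
            rw [Nat.add_mod, Nat.mod_eq_of_lt (a := 1) (by omega), Nat.mod_eq_of_lt (by omega)]
          rw [this, if_neg (Nat.succ_ne_zero _), Nat.add_sub_cancel]
        · have : (i - m + 1) % (N + 1) = 0 := by
            rw [Nat.add_mod, h', Nat.add_mod_mod, Nat.mod_self]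
          rw [this, if_pos rfl, h', hN]
  have hstart : (w' 0).src = (w 0).src := by
    rcases Nat.eq_zero_or_pos m with h | h
    · simp [w', c, h]
    · simp [w', h]
  obtain ⟨q, hq, hqe⟩ := hwin w' hpath hstart
  have h1 : ((w m).prio : ℕ) ≤ q := by
    refine hq.2 (Filter.frequently_atTop.mpr fun a => ⟨m + a * (N + 1), ?_, ?_⟩)
    · nlinarith
    · dsimp only
      rw [hper]
  have h2 : q ≤ (w m).prio := by
    obtain ⟨i, hi, hiq⟩ := Filter.frequently_atTop.mp hq.1 m
    rw [← hiq]
    simp only [w']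
    rw [if_neg (by omega)]
    exact (hcH _ (hmod _)).2
  rw [le_antisymm h1 h2]
  exact hqe

end Reachability

/-! ### The resetting strategy -/

section Strategy

variable {n d : ℕ}

open Classical in
/-- The greatest index at which a reset may happen when `e` is read: the logarithm of the size of
the component in which `e` closes a cycle, and zero if `e` does not close a cycle. -/
noncomputable def level (H : Set (Letter n d)) (e : Letter n d) : ℕ :=
  if ClosesCycle H e then Nat.log 2 (scc H e.prio e.src).card else 0

theorem level_lt (H : Set (Letter n d)) (e : Letter n d) : level H e < rn n := by
  rw [level, rn]
  split_ifs
  · have h : (scc H e.prio e.src).card ≤ n := by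
      simpa using Finset.card_le_univ (scc H e.prio e.src)
    have := Nat.log_mono_right (b := 2) h
    omega
  · omega

theorem closesCycle_of_level {H : Set (Letter n d)} {e : Letter n d} {J : ℕ} (hJ : J ≠ 0)
    (h : J ≤ level H e) : ClosesCycle H e := by
  by_contra hc
  rw [level, if_neg hc] at h
  omega

theorem pow_le_card_scc {H : Set (Letter n d)} {e : Letter n d} {J : ℕ} (h : J ≤ level H e) :
    2 ^ J ≤ (scc H e.prio e.src).card := by
  have hpos : (scc H e.prio e.src).card ≠ 0 :=
    Finset.card_ne_zero_of_mem (self_mem_scc H e.prio e.src)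
  rw [level] at h
  split_ifs at h
  · exact Nat.pow_le_of_le_log hpos h
  · rw [Nat.le_zero.mp h]
    exact Nat.one_le_iff_ne_zero.mpr hpos

theorem le_level {H : Set (Letter n d)} {e : Letter n d} {J : ℕ} (hc : ClosesCycle H e)
    (h : 2 ^ J ≤ (scc H e.prio e.src).card) : J ≤ level H e := by
  rw [level, if_pos hc]
  exact Nat.le_log_of_pow_le (by norm_num) h

open Classical in
/-- The index of the register to be reset: the greatest index, up to `level H e`, such that no
lower register holds a value above the priority of `e`. -/
noncomputable def resetIndex (H : Set (Letter n d)) (s : Registers n d) (e : Letter n d) :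
    Fin (rn n) :=
  ⟨Nat.findGreatest (fun j => ∀ i : Fin (rn n), i.val < j → (s.1 i : ℕ) ≤ e.prio) (level H e),
    lt_of_le_of_lt (Nat.findGreatest_le _) (level_lt H e)⟩

theorem resetIndex_le_level (H : Set (Letter n d)) (s : Registers n d) (e : Letter n d) :
    (resetIndex H s e).val ≤ level H e :=
  Nat.findGreatest_le _

theorem le_prio_of_lt_resetIndex {H : Set (Letter n d)} {s : Registers n d} {e : Letter n d}
    {i : Fin (rn n)} (h : i < resetIndex H s e) : (s.1 i : ℕ) ≤ e.prio := by
  classical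
  have := Nat.findGreatest_spec (m := 0) (n := level H e)
    (P := fun j => ∀ i : Fin (rn n), i.val < j → (s.1 i : ℕ) ≤ e.prio) (Nat.zero_le _)
    (fun i hi => absurd hi (Nat.not_lt_zero _))
  exact this i h

theorem le_resetIndex {H : Set (Letter n d)} {s : Registers n d} {e : Letter n d} {J : ℕ}
    (hJ : J ≤ level H e) (h : ∀ i : Fin (rn n), i.val < J → (s.1 i : ℕ) ≤ e.prio) :
    J ≤ (resetIndex H s e).val :=
  Nat.le_findGreatest hJ h

open Classical in
/-- The transition of the register automaton that resets the register with the index `k`. -/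
noncomputable def resetTransition (hd : 0 < d) (s : Registers n d) (e : Letter n d)
    (k : Fin (rn n)) : Transition (Registers n d) n d :=
  ⟨s, e, if Even ((s.update e.prio).1 k : ℕ) then 2 * (k.val + 1) else 2 * (k.val + 1) + 1,
    (s.update e.prio).reset hd k⟩

theorem isRegisterTransition_resetTransition (hd : 0 < d) (s : Registers n d) (e : Letter n d)
    (k : Fin (rn n)) : IsRegisterTransition hd (resetTransition hd s e k) := by
  unfold resetTransition
  split_ifs with h
  · exact .evenReset s e k h
  · exact .oddReset s e k (Nat.not_even_iff_odd.mp h)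

/-- The memoryless transition strategy that resets a register in each step, namely the one given by
`resetIndex`. -/
noncomputable def resetStrategy (hd : 0 < d) (H : Set (Letter n d)) :
    (registerAutomaton n d hd).TransitionStrategy where
  choose _ s e := resetTransition hd s e (resetIndex H s e)
  choose_mem _ s e := isRegisterTransition_resetTransition hd s e _
  choose_src _ _ _ := rfl
  choose_letter _ _ _ := rfl

end Strategy

/-! ### Traces of the resetting strategy -/

section Trace

variable {n d : ℕ}

/-- An infinite path `w` in `H` in which only edges of even priorities close cycles, together with
the register contents `s` before each step when the resetting strategy is followed. -/
structure IsTrace (hd : 0 < d) (H : Set (Letter n d)) (w : Word n d) (s : ℕ → Registers n d) :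
    Prop where
  isPath : IsPath H w
  even : ∀ i, ClosesCycle H (w i) → Even ((w i).prio : ℕ)
  zero : s 0 = Registers.ones n hd
  succ : ∀ i, s (i + 1) = ((s i).update (w i).prio).reset hd (resetIndex H (s i) (w i))

namespace IsTrace

variable {hd : 0 < d} {H : Set (Letter n d)} {w : Word n d} {s : ℕ → Registers n d}

theorem register_zero (h : IsTrace hd H w s) (i : ℕ) {l : Fin (rn n)} (hl : l.val = 0) :
    ((s i).1 l : ℕ) = 1 := by
  cases i with
  | zero =>
    rw [h.zero]
    rfl
  | succ i =>
    rw [h.succ]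
    exact Registers.reset_apply_zero hd _ _ hl

theorem succ_apply_le (h : IsTrace hd H w s) (i : ℕ) (l : Fin (rn n)) :
    ((s (i + 1)).1 l : ℕ) ≤ max ((s i).1 l : ℕ) ((w i).prio : ℕ) := by
  rw [h.succ, ← Registers.update_apply_coe]
  exact Registers.reset_apply_le hd _ _ l

theorem apply_le (h : IsTrace hd H w s) {a b q : ℕ} (hab : a ≤ b) {l : Fin (rn n)}
    (ha : ((s a).1 l : ℕ) ≤ q) (hq : ∀ i, a ≤ i → i < b → ((w i).prio : ℕ) ≤ q) :
    ((s b).1 l : ℕ) ≤ q := by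
  induction b, hab using Nat.le_induction with
  | base => exact ha
  | succ b hab ih =>
    exact (h.succ_apply_le b l).trans
      (max_le (ih fun i hi hib => hq i hi (by omega)) (hq b hab (by omega)))

/-- After a reset at an index other than zero, the register holds the priority just read. -/
theorem apply_resetIndex (h : IsTrace hd H w s) {a : ℕ} {J : Fin (rn n)} (hJ : J.val ≠ 0)
    (ha : resetIndex H (s a) (w a) = J) : ((s (a + 1)).1 J : ℕ) = (w a).prio := by
  rw [h.succ, Registers.reset_apply_of_le hd _ ha.ge hJ, Registers.update_apply_coe]
  refine max_eq_right (le_prio_of_lt_resetIndex (H := H) ?_)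
  rw [ha, Fin.lt_def]
  exact Nat.sub_lt (Nat.pos_of_ne_zero hJ) one_pos

/-- Between two resets at an index other than zero, with only lower resets in between, the register
collects the greatest priority read. -/
theorem exists_update_eq (h : IsTrace hd H w s) {a b : ℕ} {J : Fin (rn n)} (hJ : J.val ≠ 0)
    (hab : a < b) (ha : resetIndex H (s a) (w a) = J)
    (hlt : ∀ i, a < i → i < b → resetIndex H (s i) (w i) < J) :
    ∃ c, a ≤ c ∧ c ≤ b ∧ (((s b).update (w b).prio).1 J : ℕ) = (w c).prio ∧
      ∀ i, a ≤ i → i ≤ b → ((w i).prio : ℕ) ≤ (w c).prio := by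
  have key : ∃ c, a ≤ c ∧ c < b ∧ ((s b).1 J : ℕ) = (w c).prio ∧
      ∀ i, a ≤ i → i < b → ((w i).prio : ℕ) ≤ (w c).prio := by
    induction b, Nat.succ_le_of_lt hab using Nat.le_induction with
    | base =>
      refine ⟨a, le_rfl, Nat.lt_succ_self a, h.apply_resetIndex hJ ha, fun i h1 h2 => ?_⟩
      rw [le_antisymm (Nat.lt_succ_iff.mp h2) h1]
    | succ b hb ih =>
      obtain ⟨c, hac, hcb, hc, hmax⟩ := ih (by omega) fun i h1 h2 => hlt i h1 (by omega)
      have hs : ((s (b + 1)).1 J : ℕ) = max ((w c).prio : ℕ) ((w b).prio : ℕ) := by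
        rw [h.succ, Registers.reset_apply_of_lt hd _ (hlt b (by omega) (by omega)),
          Registers.update_apply_coe, hc]
      rcases le_total ((w c).prio : ℕ) ((w b).prio : ℕ) with hle | hle
      · refine ⟨b, by omega, by omega, by rw [hs, max_eq_right hle], fun i h1 h2 => ?_⟩
        rcases Nat.lt_succ_iff_lt_or_eq.mp h2 with h3 | h3
        · exact (hmax i h1 h3).trans hle
        · rw [h3]
      · refine ⟨c, hac, by omega, by rw [hs, max_eq_left hle], fun i h1 h2 => ?_⟩
        rcases Nat.lt_succ_iff_lt_or_eq.mp h2 with h3 | h3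
        · exact hmax i h1 h3
        · rw [h3]
          exact hle
  obtain ⟨c, hac, hcb, hc, hmax⟩ := key
  rcases le_total ((w c).prio : ℕ) ((w b).prio : ℕ) with hle | hle
  · refine ⟨b, by omega, le_rfl, by rw [Registers.update_apply_coe, hc, max_eq_right hle],
      fun i h1 h2 => ?_⟩
    rcases h2.lt_or_eq with h3 | h3
    · exact (hmax i h1 h3).trans hle
    · rw [h3]
  · refine ⟨c, hac, by omega, by rw [Registers.update_apply_coe, hc, max_eq_left hle],
      fun i h1 h2 => ?_⟩
    rcases h2.lt_or_eq with h3 | h3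
    · exact hmax i h1 h3
    · rw [h3]
      exact hle

end IsTrace

/-- The path takes the edge `w c` between components of sizes at least `2 ^ J`: the component
around the source of `w a`, and the component around the target of `w b`. The priority of `w c` is
odd and greatest among those at the positions `a, …, b`, so the path cannot have returned in
between, and the register `J` holds nothing greater after step `a`. -/
structure IsJump (H : Set (Letter n d)) (w : Word n d) (s : ℕ → Registers n d) (J : Fin (rn n))
    (a c b : ℕ) : Prop where
  le_mid : a ≤ c
  mid_le : c ≤ b
  odd : Odd ((w c).prio : ℕ)
  prio_le : ∀ i, a ≤ i → i ≤ b → ((w i).prio : ℕ) ≤ (w c).prio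
  register_le : ((s (a + 1)).1 J : ℕ) ≤ (w c).prio
  card_left : 2 ^ J.val ≤ (scc H (w a).prio (w a).src).card
  card_right : 2 ^ J.val ≤ (scc H (w b).prio (w b).tgt).card

/-- Unless a reset above the index `J` happens, a jump is never undone. Returning would close a
cycle, whose greatest edge lies in a component containing both components of the jump, thus of size
at least `2 ^ (J + 1)`; no register up to `J` is above the priority of this edge, so the strategy
resets at an index above `J`. -/
theorem IsJump.not_reach {hd : 0 < d} {H : Set (Letter n d)} {w : Word n d}
    {s : ℕ → Registers n d} (h : IsTrace hd H w s) {J : Fin (rn n)} {a c b t : ℕ}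
    (hj : IsJump H w s J a c b) (hct : c < t)
    (hle : ∀ i, a ≤ i → i < t → resetIndex H (s i) (w i) ≤ J) :
    ¬ Reach H (w c).prio (w t).src (w a).src := by
  intro hR
  have hac := hj.le_mid
  have hcb := hj.mid_le
  have hloop : ¬ Reach H (w c).prio (w (c + 1)).src (w c).src := by
    intro hcyc
    rw [← h.isPath.2 c] at hcyc
    exact Nat.not_even_iff_odd.mpr hj.odd (h.even c hcyc)
  have hac' : Reach H (w c).prio (w a).src (w c).src :=
    h.isPath.reach hac fun i h1 h2 => hj.prio_le i h1 (by omega)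
  obtain ⟨m, hm, hmax⟩ := Finset.exists_max_image (Finset.Ico a t) (fun i => ((w i).prio : ℕ))
    ⟨c, Finset.mem_Ico.mpr ⟨hac, hct⟩⟩
  rw [Finset.mem_Ico] at hm
  have hmax' : ∀ i, a ≤ i → i < t → ((w i).prio : ℕ) ≤ (w m).prio :=
    fun i h1 h2 => hmax i (Finset.mem_Ico.mpr ⟨h1, h2⟩)
  have hcm : ((w c).prio : ℕ) < (w m).prio := by
    by_contra hcon
    refine hloop (((h.isPath.reach (Nat.succ_le_of_lt hct) fun i h1 h2 => ?_).trans hR).trans hac')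
    exact (hmax' i (by omega) h2).trans (not_lt.mp hcon)
  have hbm : b < m := by
    by_contra hcon
    exact absurd (hj.prio_le m hm.1 (not_lt.mp hcon)) (not_le.mpr hcm)
  have hR' : Reach H (w m).prio (w t).src (w a).src := hR.mono hcm.le
  have ham : Reach H (w m).prio (w a).src (w m).src :=
    h.isPath.reach hm.1 fun i h1 h2 => hmax' i h1 (by omega)
  have hmt : Reach H (w m).prio (w m).src (w t).src :=
    h.isPath.reach hm.2.le fun i h1 h2 => hmax' i (by omega) h2
  have hmt' : Reach H (w m).prio (w m).tgt (w t).src := by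
    rw [h.isPath.2 m]
    exact h.isPath.reach (Nat.succ_le_of_lt hm.2) fun i h1 h2 => hmax' i (by omega) h2
  have hab : Reach H (w m).prio (w a).src (w b).tgt := by
    rw [h.isPath.2 b]
    exact h.isPath.reach (by omega) fun i h1 h2 => hmax' i h1 (by omega)
  have hbm' : Reach H (w m).prio (w b).tgt (w m).src := by
    rw [h.isPath.2 b]
    exact h.isPath.reach (Nat.succ_le_of_lt hbm) fun i h1 h2 => hmax' i (by omega) (by omega)
  have hdisj : Disjoint (scc H (w a).prio (w a).src) (scc H (w b).prio (w b).tgt) := by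
    rw [Finset.disjoint_left]
    intro z hza hzb
    rw [mem_scc] at hza hzb
    have hcb' : Reach H (w c).prio (w (c + 1)).src (w b).tgt := by
      rw [h.isPath.2 b]
      exact h.isPath.reach (by omega) fun i h1 h2 => hj.prio_le i (by omega) (by omega)
    exact hloop (((hcb'.trans (hzb.1.mono (hj.prio_le b (by omega) le_rfl))).trans
      (hza.2.mono (hj.prio_le a le_rfl (by omega)))).trans hac')
  have hsub : scc H (w a).prio (w a).src ∪ scc H (w b).prio (w b).tgt ⊆
      scc H (w m).prio (w m).src :=
    Finset.union_subset (scc_subset (hmax' a le_rfl (by omega)) (hmt.trans hR') ham)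
      (scc_subset (hmax' b (by omega) (by omega)) ((hmt.trans hR').trans hab) hbm')
  have hcard : 2 ^ (J.val + 1) ≤ (scc H (w m).prio (w m).src).card := by
    have := Finset.card_le_card hsub
    rw [Finset.card_union_of_disjoint hdisj] at this
    have h1 := hj.card_left
    have h2 := hj.card_right
    rw [pow_succ]
    omega
  have hreg : ((s m).1 J : ℕ) ≤ (w m).prio :=
    h.apply_le (by omega) (hj.register_le.trans hcm.le) fun i h1 h2 =>
      hmax' i (by omega) (by omega)
  have hreset : J.val + 1 ≤ (resetIndex H (s m) (w m)).val :=
    le_resetIndex (le_level ((hmt'.trans hR').trans ham) hcard) fun i hi =>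
      (Subtype.coe_le_coe.mpr ((s m).2 (Fin.le_def.mpr (Nat.lt_succ_iff.mp hi)))).trans hreg
  have := Fin.le_def.mp (hle m hm.1 hm.2)
  omega

/-- Starting points of consecutive jumps are pairwise different, and differ from the node reached at
the end. This leaves room for fewer than `n` jumps, and for one fewer still if there is a further
node `y`. -/
theorem card_jumps_lt {hd : 0 < d} {H : Set (Letter n d)} {w : Word n d}
    {s : ℕ → Registers n d} (h : IsTrace hd H w s) {J : Fin (rn n)} {A B : ℕ}
    (hle : ∀ i, A ≤ i → i < B → resetIndex H (s i) (w i) ≤ J) (T : Finset ℕ) (f g : ℕ → ℕ)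
    (hT : ∀ b ∈ T, A ≤ f b ∧ b < B ∧ IsJump H w s J (f b) (g b) b)
    (hord : ∀ b ∈ T, ∀ b' ∈ T, b < b' → g b < f b') :
    T.card < n ∧ ∀ y, (∀ b ∈ T, y ≠ (w (f b)).src) → y ≠ (w B).src → T.card + 1 < n := by
  classical
  have hne : ∀ b ∈ T, ∀ t, g b < t → t ≤ B → (w t).src ≠ (w (f b)).src := by
    intro b hb t hgt htB heq
    refine (hT b hb).2.2.not_reach h hgt (fun i h1 h2 => ?_) ?_
    · exact hle i ((hT b hb).1.trans h1) (by omega)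
    · rw [heq]
      exact Relation.ReflTransGen.refl
  have hinj : Set.InjOn (fun b => (w (f b)).src) T := by
    have hlt : ∀ b ∈ T, ∀ b' ∈ T, b < b' → (w (f b')).src ≠ (w (f b)).src := by
      intro b hb b' hb' hbb'
      have := (hT b' hb').2.1
      have := (hT b' hb').2.2.le_mid
      have := (hT b' hb').2.2.mid_le
      exact hne b hb _ (hord b hb b' hb' hbb') (by omega)
    intro b hb b' hb' heq
    rcases lt_trichotomy b b' with hbb' | hbb' | hbb'
    · exact absurd heq.symm (hlt b hb b' hb' hbb')
    · exact hbb'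
    · exact absurd heq (hlt b' hb' b hb hbb')
  have hlast : (w B).src ∉ T.image fun b => (w (f b)).src := by
    rw [Finset.mem_image]
    rintro ⟨b, hb, heq⟩
    have h1 := (hT b hb).2.2.mid_le
    have h2 := (hT b hb).2.1
    exact hne b hb B (by omega) le_rfl heq.symm
  have hcard : (insert (w B).src (T.image fun b => (w (f b)).src)).card = T.card + 1 := by
    rw [Finset.card_insert_of_notMem hlast, Finset.card_image_of_injOn hinj]
  constructor
  · have := Finset.card_le_univ (insert (w B).src (T.image fun b => (w (f b)).src))
    rw [hcard, Fintype.card_fin] at this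
    omega
  · intro y hy hyB
    have hy' : y ∉ insert (w B).src (T.image fun b => (w (f b)).src) := by
      rw [Finset.mem_insert, Finset.mem_image]
      rintro (hyy | ⟨b, hb, heq⟩)
      · exact hyB hyy
      · exact hy b hb heq.symm
    have := Finset.card_le_univ (insert y (insert (w B).src (T.image fun b => (w (f b)).src)))
    rw [Finset.card_insert_of_notMem hy', hcard, Fintype.card_fin] at this
    omega

/-- While no register above `J` is reset, fewer than `n` odd resets at the index `J` happen. -/
theorem IsTrace.card_odd_resets_lt {hd : 0 < d} {H : Set (Letter n d)} {w : Word n d}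
    {s : ℕ → Registers n d} (h : IsTrace hd H w s) (J : Fin (rn n)) (A B : ℕ)
    (hle : ∀ i, A ≤ i → i < B → resetIndex H (s i) (w i) ≤ J) (T : Finset ℕ)
    (hT : ∀ b ∈ T, A ≤ b ∧ b < B ∧ resetIndex H (s b) (w b) = J ∧
      Odd (((s b).update (w b).prio).1 J : ℕ)) : T.card < n := by
  classical
  by_cases hJ : J.val = 0
  · refine (card_jumps_lt h hle T id id (fun b hb => ?_)
      fun b _ b' _ hbb' => hbb').1
    obtain ⟨hA, hB, -, hodd⟩ := hT b hb
    rw [Registers.update_apply_coe, h.register_zero b hJ, max_eq_right (w b).prio.2.1] at hodd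
    have hpos : ∀ p x, 2 ^ J.val ≤ (scc H p x).card := by
      intro p x
      rw [hJ, pow_zero]
      exact Finset.card_pos.mpr ⟨x, self_mem_scc H p x⟩
    refine ⟨hA, hB, le_rfl, le_rfl, hodd, fun i h1 h2 => ?_, ?_, hpos _ _, hpos _ _⟩
    · rw [le_antisymm h2 h1]
      rfl
    · rw [h.register_zero _ hJ]
      exact (w _).prio.2.1
  · -- All resets at `J` happen on edges closing cycles in components of at least `2 ^ J` nodes.
    have hlevel : ∀ b, resetIndex H (s b) (w b) = J → J.val ≤ level H (w b) := by
      intro b hb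
      have := resetIndex_le_level H (s b) (w b)
      rwa [hb] at this
    have hcyc : ∀ b, resetIndex H (s b) (w b) = J → ClosesCycle H (w b) :=
      fun b hb => closesCycle_of_level hJ (hlevel b hb)
    have hcl : ∀ b, resetIndex H (s b) (w b) = J →
        2 ^ J.val ≤ (scc H (w b).prio (w b).src).card :=
      fun b hb => pow_le_card_scc (hlevel b hb)
    have hcr : ∀ b, resetIndex H (s b) (w b) = J →
        2 ^ J.val ≤ (scc H (w b).prio (w b).tgt).card := by
      intro b hb
      refine (hcl b hb).trans (Finset.card_le_card (scc_subset le_rfl (hcyc b hb) ?_))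
      exact Relation.ReflTransGen.single ⟨w b, h.isPath.1 b, rfl, rfl, le_rfl⟩
    have htwo : 2 ≤ 2 ^ J.val := by
      calc 2 = 2 ^ 1 := rfl
        _ ≤ 2 ^ J.val := Nat.pow_le_pow_right (by norm_num) (Nat.one_le_iff_ne_zero.mpr hJ)
    rcases T.eq_empty_or_nonempty with rfl | hTne
    · simpa using (w 0).src.pos
    have hmin := T.min'_mem hTne
    set b₀ := T.min' hTne with hb₀
    -- Each odd reset at `J` but the first ends a jump from the preceding reset at `J`.
    have hjump : ∀ b ∈ T.erase b₀, ∃ a c, A ≤ a ∧ a < b ∧ (∀ b' ∈ T, b' < b → b' ≤ a) ∧ c < b ∧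
        IsJump H w s J a c b := by
      intro b hb
      have hbT := Finset.mem_of_mem_erase hb
      have hb₀b : b₀ < b := lt_of_le_of_ne (T.min'_le b hbT) (Finset.ne_of_mem_erase hb).symm
      obtain ⟨hA, hB, hbJ, hodd⟩ := hT b hbT
      obtain ⟨a, ha, hamax⟩ := Finset.exists_max_image
        ((Finset.Ico A b).filter fun i => resetIndex H (s i) (w i) = J) id
        ⟨b₀, Finset.mem_filter.mpr
          ⟨Finset.mem_Ico.mpr ⟨(hT b₀ hmin).1, hb₀b⟩, (hT b₀ hmin).2.2.1⟩⟩
      simp only [Finset.mem_filter, Finset.mem_Ico, id] at ha hamax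
      obtain ⟨⟨hAa, hab⟩, haJ⟩ := ha
      obtain ⟨c, hac, hcb, hc, hmax⟩ := h.exists_update_eq hJ hab haJ fun i h1 h2 =>
        lt_of_le_of_ne (hle i (by omega) (by omega)) fun heq => by
          have := hamax i ⟨⟨by omega, h2⟩, heq⟩
          omega
      rw [hc] at hodd
      have hcb' : c ≠ b := by
        rintro rfl
        exact Nat.not_even_iff_odd.mpr hodd (h.even c (hcyc c hbJ))
      refine ⟨a, c, hAa, hab, fun b' hb' hlt => ?_, lt_of_le_of_ne hcb hcb', hac, hcb, hodd, hmax,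
        ?_, hcl a haJ, hcr b hbJ⟩
      · exact hamax b' ⟨⟨(hT b' hb').1, hlt⟩, (hT b' hb').2.2.1⟩
      · rw [h.apply_resetIndex hJ haJ]
        exact hmax a le_rfl hab.le
    choose! f g hAf hfb hlast hgb hjump' using hjump
    have hcount := card_jumps_lt h hle (T.erase b₀) f g
      (fun b hb => ⟨hAf b hb, (hT b (Finset.mem_of_mem_erase hb)).2.1, hjump' b hb⟩)
      (fun b hb b' hb' hbb' => lt_of_lt_of_le (hgb b hb)
        (hlast b' hb' b (Finset.mem_of_mem_erase hb) hbb'))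
    rw [Finset.card_erase_of_mem hmin] at hcount
    rcases (T.erase b₀).eq_empty_or_nonempty with hempty | hne
    · have h1 := Finset.card_erase_of_mem hmin
      rw [hempty, Finset.card_empty] at h1
      have h2 := (htwo.trans (hcl b₀ (hT b₀ hmin).2.2.1)).trans (Finset.card_le_univ _)
      rw [Fintype.card_fin] at h2
      omega
    · -- The component from which the first jump starts contains one more node, and it is left
      -- forever.
      have hb₁ := (T.erase b₀).min'_mem hne
      set b₁ := (T.erase b₀).min' hne with hb₁def
      have hj := hjump' b₁ hb₁
      obtain ⟨y, hy, hyne⟩ := Finset.exists_mem_ne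
        (lt_of_lt_of_le one_lt_two (htwo.trans hj.card_left)) (w (f b₁)).src
      have hyreach : Reach H (w (g b₁)).prio y (w (f b₁)).src :=
        (mem_scc.mp hy).2.mono (hj.prio_le _ le_rfl (hfb b₁ hb₁).le)
      have hleft : ∀ t, g b₁ < t → t ≤ B → y ≠ (w t).src := by
        rintro t h1 h2 rfl
        exact hj.not_reach h h1
          (fun i h3 h4 => hle i ((hAf b₁ hb₁).trans h3) (by omega)) hyreach
      have hB₁ := (hT b₁ (Finset.mem_of_mem_erase hb₁)).2.1
      have hg₁ := hgb b₁ hb₁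
      have := hcount.2 y (fun b hb => ?_) (hleft B (by omega) le_rfl)
      · omega
      · rcases ((T.erase b₀).min'_le b hb).lt_or_eq with hlt | heq
        · have h1 := hlast b hb b₁ (Finset.mem_of_mem_erase hb₁) hlt
          have h2 := hfb b hb
          have h3 := (hT b (Finset.mem_of_mem_erase hb)).2.1
          exact hleft _ (by omega) (by omega)
        · rw [← heq]
          exact hyne

end Trace

/-! ### Runs following the resetting strategy -/

section Runs

variable {n d : ℕ}

/-- The edges that may be used when the player follows the positional strategy `τ`. -/
def PositionalStrategy.edges {G : GameGraph n d} {P : Player} (τ : PositionalStrategy G P) :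
    Set (Letter n d) :=
  {e | e ∈ G.edges ∧ (G.owner e.src = P → e ∈ τ.chosen)}

theorem PositionalStrategy.mem_plays_iff {G : GameGraph n d} {P : Player}
    {τ : PositionalStrategy G P} {w : Word n d} :
    w ∈ τ.plays ↔ IsPath τ.edges w ∧ (w 0).src = G.start :=
  ⟨fun h => ⟨⟨fun i => ⟨h.1.2.1 i, h.2 i⟩, h.1.2.2⟩, h.1.1⟩,
    fun h => ⟨⟨h.2, fun i => (h.1.1 i).1, h.1.2⟩, fun i => (h.1.1 i).2⟩⟩

namespace ParityAutomaton

/-- A transition strategy can be followed on every word. -/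
theorem TransitionStrategy.exists_run {A : ParityAutomaton n d} (σ : A.TransitionStrategy)
    (w : Word n d) : ∃ ρ : A.Run, ρ.word = w ∧ ρ.Follows σ := by
  let q : ℕ → A.State := fun i =>
    Nat.rec A.initial (fun i s => (σ.choose ((List.range i).map w) s (w i)).tgt) i
  let t : ℕ → Transition A.State n d := fun i => σ.choose ((List.range i).map w) (q i) (w i)
  have hword : (fun i => (t i).letter) = w := funext fun i => σ.choose_letter _ _ _
  refine ⟨⟨t, fun i => σ.choose_mem _ _ _, σ.choose_src _ _ _,
    fun i => (σ.choose_src _ _ _).symm⟩, hword, fun i => ?_⟩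
  change t i = σ.choose ((List.range i).map fun i => (t i).letter) (t i).src
    ((fun i => (t i).letter) i)
  rw [hword, show (t i).src = q i from σ.choose_src _ _ _]

/-- A run of which some odd priority is the greatest one emitted infinitely often contains blocks
in which this priority is the greatest one and occurs arbitrarily many times. -/
theorem Run.accepting_of_bad_le {A : ParityAutomaton n d} (ρ : A.Run) {N : ℕ}
    (h : ρ.bad ≤ (N : ℕ∞)) : ρ.Accepting := by
  have hbdd : ∀ i, (ρ.step i).prio ≤ A.maxPrio := fun i => (A.prio_mem _ (ρ.step_mem i)).2
  obtain ⟨p, hp⟩ := exists_isLimsupPrio hbdd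
  refine ⟨p, hp, ?_⟩
  by_contra hodd
  rw [Nat.not_even_iff_odd] at hodd
  obtain ⟨a, ha⟩ := Filter.eventually_atTop.mp (hp.eventually_le hbdd)
  have hinf : Set.Infinite {i | a ≤ i ∧ (ρ.step i).prio = p} := by
    rw [Nat.frequently_atTop_iff_infinite.symm]
    exact (Filter.eventually_ge_atTop a).and_frequently hp.1
  obtain ⟨T, hT, hcard⟩ := hinf.exists_subset_card_eq (N + 1)
  have hmem : (((Finset.Ico a (T.sup id + 1)).filter
      (fun i => (ρ.step i).prio = p)).card : ℕ∞) ≤ ρ.bad :=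
    le_sSup ⟨a, T.sup id + 1, p, hodd, fun i hi => ha i (Finset.mem_Ico.mp hi).1, rfl⟩
  have hsub : T ⊆ (Finset.Ico a (T.sup id + 1)).filter (fun i => (ρ.step i).prio = p) := by
    intro i hi
    have h1 := hT (Finset.mem_coe.mpr hi)
    have h2 : i ≤ T.sup id := Finset.le_sup (f := id) hi
    exact Finset.mem_filter.mpr ⟨Finset.mem_Ico.mpr ⟨h1.1, by omega⟩, h1.2⟩
  have := Finset.card_le_card hsub
  have h3 := Nat.cast_le.mp (hmem.trans h)
  omega

end ParityAutomaton

theorem isTrace_of_follows {hd : 0 < d} {G : GameGraph n d}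
    {τ : PositionalStrategy G Player.even} (hτ : τ.IsWinning)
    {ρ : (registerAutomaton n d hd).Run} (hρ : ρ.Follows (resetStrategy hd τ.edges))
    (hw : ρ.word ∈ τ.plays) : IsTrace hd τ.edges ρ.word (fun i => (ρ.step i).src) where
  isPath := (PositionalStrategy.mem_plays_iff.mp hw).1
  even i hi := by
    rw [PositionalStrategy.mem_plays_iff] at hw
    exact hi.even hw.1 fun w' hw' hs =>
      hτ w' (PositionalStrategy.mem_plays_iff.mpr ⟨hw', hs.trans hw.2⟩)
  zero := ρ.step_zero
  succ i := by
    rw [← ρ.step_succ i, hρ i]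
    rfl

theorem bad_le_of_follows {hd : 0 < d} {G : GameGraph n d}
    {τ : PositionalStrategy G Player.even} (hτ : τ.IsWinning)
    {ρ : (registerAutomaton n d hd).Run} (hρ : ρ.Follows (resetStrategy hd τ.edges))
    (hw : ρ.word ∈ τ.plays) : ρ.bad ≤ ((n - 1 : ℕ) : ℕ∞) := by
  classical
  have htrace := isTrace_of_follows hτ hρ hw
  let s : ℕ → Registers n d := fun i => (ρ.step i).src
  have hprio : ∀ i, (ρ.step i).prio =
      if Even (((s i).update (ρ.word i).prio).1 (resetIndex τ.edges (s i) (ρ.word i)) : ℕ)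
      then 2 * ((resetIndex τ.edges (s i) (ρ.word i)).val + 1)
      else 2 * ((resetIndex τ.edges (s i) (ρ.word i)).val + 1) + 1 := by
    intro i
    rw [hρ i]
    simp only [resetStrategy, resetTransition]
    congr
  refine sSup_le ?_
  rintro m ⟨A, B, p, hp, hle, rfl⟩
  rw [Nat.cast_le]
  rcases ((Finset.Ico A B).filter fun i => (ρ.step i).prio = p).eq_empty_or_nonempty with
    hT | ⟨b, hb⟩
  · simp [hT]
  rw [Finset.mem_filter] at hb
  have hodd : ∀ i, (ρ.step i).prio = p →
      Odd (((s i).update (ρ.word i).prio).1 (resetIndex τ.edges (s i) (ρ.word i)) : ℕ) ∧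
      p = 2 * ((resetIndex τ.edges (s i) (ρ.word i)).val + 1) + 1 := by
    intro i hi
    have h := hprio i
    rw [hi] at h
    split_ifs at h with hev
    · rw [h] at hp
      exact absurd (even_two_mul _) (Nat.not_even_iff_odd.mpr hp)
    · exact ⟨Nat.not_even_iff_odd.mp hev, h⟩
  have hbp := (hodd b hb.2).2
  refine Nat.le_sub_one_of_lt (htrace.card_odd_resets_lt
    (resetIndex τ.edges (s b) (ρ.word b)) A B (fun i h1 h2 => ?_) _ fun i hi => ?_)
  · have h3 := hle i (Finset.mem_Ico.mpr ⟨h1, h2⟩)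
    rw [hprio i] at h3
    refine Fin.le_def.mpr ?_
    simp only [s] at h3 hbp ⊢
    split_ifs at h3 <;> omega
  · rw [Finset.mem_filter, Finset.mem_Ico] at hi
    obtain ⟨ho, hip⟩ := hodd i hi.2
    have heq : resetIndex τ.edges (s i) (ρ.word i) = resetIndex τ.edges (s b) (ρ.word b) :=
      Fin.ext (by omega)
    rw [heq] at ho
    exact ⟨hi.1.1, hi.1.2, heq, ho⟩

theorem winningFor_resetStrategy (hd : 0 < d) {G : GameGraph n d}
    {τ : PositionalStrategy G Player.even} (hτ : τ.IsWinning) :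
    (resetStrategy hd τ.edges).WinningFor τ.plays := by
  intro w hw
  obtain ⟨ρ, rfl, hρ⟩ := (resetStrategy hd τ.edges).exists_run w
  exact ⟨ρ, rfl, hρ, ρ.accepting_of_bad_le (bad_le_of_follows hτ hρ hw)⟩

end Runs

theorem isStrongSFPGSeparator_registerAutomaton (n d : ℕ) (hd : 0 < d) :
    (registerAutomaton n d hd).IsStrongSFPGSeparator := by
  have hsep : (registerAutomaton n d hd).IsPGSeparator := by
    constructor
    · rintro w ⟨G, τ, hτ, hw⟩
      obtain ⟨ρ, hρ, -, hacc⟩ := winningFor_resetStrategy hd hτ w hw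
      exact ⟨ρ, hρ, hacc⟩
    · rintro w ⟨G, τ, hτ, hw⟩
      exact odd_limsup_not_mem_language hd (hτ w hw)
  exact ⟨⟨hsep, fun w => odd_limsup_not_mem_language hd⟩,
    hsep, fun G τ hτ => ⟨_, winningFor_resetStrategy hd hτ⟩⟩

end ParityGames

theorem mainTheorem2 (n d : ℕ) (hn : 0 < n) (hd : 0 < d) (hd_even : Even d) :
    (ParityGames.registerAutomaton n d hd).IsStrongSFPGSeparator ∧
      ∀ (G : ParityGames.GameGraph n d)
        (τ : ParityGames.PositionalStrategy G ParityGames.Player.even), τ.IsWinning →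
        ∃ σ : (ParityGames.registerAutomaton n d hd).TransitionStrategy,
          σ.WinningFor τ.plays ∧
          ∀ ρ : (ParityGames.registerAutomaton n d hd).Run,
            ρ.Follows σ → ρ.word ∈ τ.plays → ρ.bad ≤ ((n - 1 : ℕ) : ℕ∞) :=
  ⟨ParityGames.isStrongSFPGSeparator_registerAutomaton n d hd, fun _ τ hτ =>
    ⟨ParityGames.resetStrategy hd τ.edges, ParityGames.winningFor_resetStrategy hd hτ,
      fun _ hρ hw => ParityGames.bad_le_of_follows hτ hρ hw⟩⟩
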